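/- **Theorem 1.3 (Halter-Koch–Yamamoto criterion).** A *quadratic discriminant* is a non-square integer $d>0$ with $d\equiv 0$ or $1 \pmod 4$. For such $d$ let $\omega_d=\frac{\sqrt d}{2}$ if $d\equiv 0 \pmod 4$ and $\omega_d=\frac{1+\sqrt d}{2}$ if $d\equiv 1\pmod 4$, let $\mathcal{O}_d=\mathbb{Z}[\omega_d]\subset\mathbb{R}$ be the quadratic order of discriminant $d$, let $\xi_d>1$ be its fundamental unit (so $\mathcal{O}_d^{*}=\{\pm\xi_d^k: k\in\mathbb{Z}\}$), and let $d_0$ be the fundamental discriminant associated with $d$, i.e. the discriminant of the field $\mathbb{Q}(\sqrt d)$, so that $d=d_0f^2$ with $f\in\mathbb{N}$. The norm of a nonzero ideal $\mathfrak a$ of $\mathcal{O}_d$ is $N(\mathfrak a)=|\mathcal{O}_d/\mathfrak a|$. An ideal of $\mathcal{O}_d$ is called *reduced* if it has the form $a\mathbb{Z}+\frac{b+\sqrt d}{2}\mathbb{Z}$ with $a,b\in\mathbb{Z}$, $a>0$, $4a\mid b^2-d$, $\gcd\left(a,b,\frac{b^2-d}{4a}\right)=1$, and $$\frac{b+\sqrt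 d}{2a}>1,\qquad -1<\frac{b-\sqrt d}{2a}<0 .$$ Let $m\ge 0$, let $n_1,\dots,n_m\ge 2$ be integers, and let $\mathfrak{D}$ be an infinite set of quadratic discriminants $d>0$ such that for every $d\in\mathfrak{D}$: - (a) each of $n_1,\dots,n_m$ is the norm of a reduced principal ideal of $\mathcal{O}_d$; - (b) each $n_i$ decomposes as $n_i=n_i'n_i''$ with natural numbers $n_i',n_i''$ (which may depend on $d$) such that - (b1) $n_i'\neq 1$ and $n_i'$ is coprime to $d$; - (b2) $n_i''$ is a squarefree divisor of $d_0$; - (b3) $n_1',\dots,n_m'$ are pairwise coprime. Then $$\log\xi_d\gg(\log\sqrt d)^{m+1}\qquad(d\in\mathfrak{D}),$$ that is, there is a constant $c>0$, depending only on $n_1,\dots,n_m$ and $\mathfrak{D}$, with $\log\xi_d\ge c\,(\log\sqrt d)^{m+1}$ for all $d\in\mathfrak{D}$. -/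

import Mathlib

noncomputable section

/-- A (positive, quadratic) discriminant: a natural number that is not a square and is congruent
to 0 or 1 modulo 4. -/
def IsQuadraticDiscriminant (d : ℕ) : Prop :=
  ¬ IsSquare d ∧ (d % 4 = 0 ∨ d % 4 = 1)

/-- A (positive) fundamental discriminant, i.e. the discriminant of a real quadratic field. -/
def IsFundamentalDiscriminant (D : ℕ) : Prop :=
  D ≠ 1 ∧ ((D % 4 = 1 ∧ Squarefree D) ∨
    ∃ k : ℕ, D = 4 * k ∧ Squarefree k ∧ (k % 4 = 2 ∨ k % 4 = 3))

/-- `D` is the fundamental discriminant of the field `ℚ(√d)`. -/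
def IsFundamentalDiscriminantOf (D d : ℕ) : Prop :=
  IsFundamentalDiscriminant D ∧ ∃ f : ℕ, d = D * f ^ 2

/-- `√d / 2` if `d` is even and `(1 + √d) / 2` if `d` is odd. -/
def quadOmega (d : ℕ) : ℝ := (((d % 2 : ℕ) : ℝ) + √(d : ℝ)) / 2

/-- The quadratic order `ℤ[ω_d]` of discriminant `d`, as a subring of `ℝ`. -/
def quadOrder (d : ℕ) : Subalgebra ℤ ℝ := Algebra.adjoin ℤ {quadOmega d}

/-- The norm of an ideal: the cardinality of the residue ring. -/
def idealNorm {d : ℕ} (I : Ideal (quadOrder d)) : ℕ := Nat.card (quadOrder d ⧸ I)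

/-- A quadratic irrational `(b + √d) / (2a)` of discriminant `d`: here `a > 0`, the integer
`c = (b² - d) / (4a)` (which is determined by `a`, `b`, `d`) and `a`, `b` have no common factor. -/
structure QuadraticIrrational (d : ℕ) where
  a : ℤ
  b : ℤ
  c : ℤ
  a_pos : 0 < a
  disc : b ^ 2 - (d : ℤ) = 4 * a * c
  coprime : Int.gcd a (Int.gcd b c) = 1

namespace QuadraticIrrational

variable {d : ℕ}

/-- The real number `ρ = (b + √d) / (2a)`. -/
def val (ρ : QuadraticIrrational d) : ℝ := ((ρ.b : ℝ) + √(d : ℝ)) / (2 * (ρ.a : ℝ))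

/-- The Galois conjugate `ρ' = (b - √d) / (2a)`. -/
def conj (ρ : QuadraticIrrational d) : ℝ := ((ρ.b : ℝ) - √(d : ℝ)) / (2 * (ρ.a : ℝ))

/-- `ρ` is reduced: `ρ > 1` and `-1 < ρ' < 0`. -/
def IsReduced (ρ : QuadraticIrrational d) : Prop :=
  1 < ρ.val ∧ -1 < ρ.conj ∧ ρ.conj < 0

/-- The lattice `θ(ρ) = a ℤ + ((b + √d) / 2) ℤ` in `ℝ`. -/
def theta (ρ : QuadraticIrrational d) : Submodule ℤ ℝ :=
  Submodule.span ℤ {(ρ.a : ℝ), ((ρ.b : ℝ) + √(d : ℝ)) / 2}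

end QuadraticIrrational

/-- An ideal of the order is reduced if it equals `θ(ρ)` (as a subset of `ℝ`) for some reduced
quadratic irrational `ρ` of discriminant `d`. -/
def IsReducedIdeal {d : ℕ} (I : Ideal (quadOrder d)) : Prop :=
  ∃ ρ : QuadraticIrrational d, ρ.IsReduced ∧
    (fun x : quadOrder d => (x : ℝ)) '' (I : Set (quadOrder d)) = (ρ.theta : Set ℝ)

/-- `ξ > 1` is a fundamental unit: every unit of the order is `± ξ ^ k` for some `k ∈ ℤ`. -/
def IsFundamentalUnit {d : ℕ} (ξ : (quadOrder d)ˣ) : Prop :=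
  1 < ((ξ : quadOrder d) : ℝ) ∧ ∀ u : (quadOrder d)ˣ, ∃ k : ℤ, u = ξ ^ k ∨ u = -ξ ^ k

theorem sqrt_mem_quadOrder (d : ℕ) : √(d : ℝ) ∈ quadOrder d := by
  have h1 : quadOmega d ∈ quadOrder d := Algebra.subset_adjoin rfl
  have h : √(d : ℝ) = quadOmega d + quadOmega d - ((d % 2 : ℕ) : ℝ) := by
    unfold quadOmega; ring
  rw [h]
  exact sub_mem (add_mem h1 h1) (natCast_mem _ _)

/-- Every element of the order is `(x + y √d) / 2` with `x ≡ d y (mod 2)`. -/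
theorem exists_of_mem_quadOrder {d : ℕ} (hd : IsQuadraticDiscriminant d) {z : ℝ}
    (hz : z ∈ quadOrder d) :
    ∃ x y : ℤ, (4 : ℤ) ∣ x ^ 2 - (d : ℤ) * y ^ 2 ∧ z = ((x : ℝ) + y * √(d : ℝ)) / 2 := by
  obtain ⟨r, hr⟩ : ∃ r : ℤ, ((d % 2 : ℕ) : ℤ) = r := ⟨_, rfl⟩
  have hω0 : quadOmega d = ((r : ℝ) + √(d : ℝ)) / 2 := by
    rw [← hr]; rfl
  have key : ∃ p q : ℤ, z = p + q * quadOmega d := by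
    have hsq : √(d : ℝ) * √(d : ℝ) = d := Real.mul_self_sqrt (Nat.cast_nonneg d)
    obtain ⟨e, he⟩ : ∃ e : ℤ, (d : ℤ) = 4 * e + r := by
      refine ⟨((d / 4 : ℕ) : ℤ), ?_⟩
      have := hd.2
      omega
    have he' : (d : ℝ) = 4 * e + r := by
      have := congrArg (fun t : ℤ => (t : ℝ)) he
      push_cast at this
      exact this
    have hrr : (r : ℝ) * r = r := by
      have : r = 0 ∨ r = 1 := by omega
      rcases this with rfl | rfl <;> norm_num
    have hω : quadOmega d * quadOmega d = e + r * quadOmega d := by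
      rw [hω0]
      linear_combination (1 / 4) * hsq + (1 / 4) * he' - (1 / 4) * hrr
    induction hz using Algebra.adjoin_induction with
    | mem x hx => exact ⟨0, 1, by rw [Set.mem_singleton_iff.1 hx]; push_cast; ring⟩
    | algebraMap t => exact ⟨t, 0, by simp⟩
    | add x y _ _ hx hy =>
      obtain ⟨p, q, rfl⟩ := hx
      obtain ⟨p', q', rfl⟩ := hy
      exact ⟨p + p', q + q', by push_cast; ring⟩
    | mul x y _ _ hx hy =>
      obtain ⟨p, q, rfl⟩ := hx
      obtain ⟨p', q', rfl⟩ := hy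
      refine ⟨p * p' + q * q' * e, p * q' + q * p' + q * q' * r, ?_⟩
      push_cast
      linear_combination (q : ℝ) * q' * hω
  obtain ⟨p, q, rfl⟩ := key
  refine ⟨2 * p + q * r, q, ?_, by rw [hω0]; push_cast; ring⟩
  rw [← hr]
  rcases hd.2 with h | h
  · have h2 : d % 2 = 0 := by omega
    obtain ⟨e, he⟩ : ∃ e : ℤ, (d : ℤ) = 4 * e := ⟨((d / 4 : ℕ) : ℤ), by omega⟩
    rw [h2, he]
    exact ⟨p ^ 2 - e * q ^ 2, by push_cast; ring⟩
  · have h2 : d % 2 = 1 := by omega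
    obtain ⟨e, he⟩ : ∃ e : ℤ, (d : ℤ) = 4 * e + 1 := ⟨((d / 4 : ℕ) : ℤ), by omega⟩
    rw [h2, he]
    exact ⟨p ^ 2 + p * q - e * q ^ 2, by push_cast; ring⟩

theorem IsQuadraticDiscriminant.five_le {d : ℕ} (hd : IsQuadraticDiscriminant d) : 5 ≤ d := by
  obtain ⟨h1, h2⟩ := hd
  by_contra h
  have h3 : d = 0 ∨ d = 1 ∨ d = 4 := by omega
  rcases h3 with rfl | rfl | rfl
  · exact h1 ⟨0, rfl⟩
  · exact h1 ⟨1, rfl⟩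
  · exact h1 ⟨2, rfl⟩

/-- There are no units strictly between 1 and 11/10. -/
theorem quadOrder_unit_gap {d : ℕ} (hd : IsQuadraticDiscriminant d) (u : (quadOrder d)ˣ)
    (h1 : 1 < ((u : quadOrder d) : ℝ)) : 11 / 10 ≤ ((u : quadOrder d) : ℝ) := by
  by_contra! h2
  obtain ⟨x, y, hxy, hu⟩ := exists_of_mem_quadOrder hd (u : quadOrder d).2
  obtain ⟨z, w, hzw, hv⟩ := exists_of_mem_quadOrder hd ((u⁻¹ : (quadOrder d)ˣ) : quadOrder d).2
  have huv : ((u : quadOrder d) : ℝ) * (((u⁻¹ : (quadOrder d)ˣ) : quadOrder d) : ℝ) = 1 := by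
    exact congrArg (fun t : quadOrder d => (t : ℝ)) (Units.mul_inv u)
  set U : ℝ := ((u : quadOrder d) : ℝ) with hU
  set V : ℝ := (((u⁻¹ : (quadOrder d)ˣ) : quadOrder d) : ℝ) with hV
  have hs0 : 0 ≤ √(d : ℝ) := Real.sqrt_nonneg _
  have hsq : √(d : ℝ) * √(d : ℝ) = d := Real.mul_self_sqrt (Nat.cast_nonneg d)
  have hd5 : (5 : ℝ) ≤ d := by exact_mod_cast hd.five_le
  have hirr : Irrational √(d : ℝ) := irrational_sqrt_natCast_iff.2 hd.1
  have hprod : ((x * z + d * (y * w) - 4 : ℤ) : ℝ) + ((x * w + y * z : ℤ) : ℝ) * √(d : ℝ) = 0 := by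
    push_cast
    have h4 : ((x : ℝ) + y * √(d : ℝ)) * ((z : ℝ) + w * √(d : ℝ)) = 4 := by
      rw [hu, hv] at huv; linarith
    linear_combination h4 - (y : ℝ) * w * hsq
  have hw0 : x * w + y * z = 0 := by
    by_contra hne
    have := (hirr.intCast_mul hne).intCast_add (x * z + d * (y * w) - 4)
    exact this.ne_zero hprod
  have hz0 : x * z + d * (y * w) = 4 := by
    rw [hw0] at hprod
    have : ((x * z + d * (y * w) - 4 : ℤ) : ℝ) = 0 := by simpa using hprod
    have := Int.cast_eq_zero.1 this
    omega
  have hnorm : (x ^ 2 - d * y ^ 2) * (z ^ 2 - d * w ^ 2) = 16 := by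
    linear_combination (x * z + d * (y * w) + 4) * hz0 - d * (x * w + y * z) * hw0
  obtain ⟨s, hs⟩ := hxy
  obtain ⟨t, ht⟩ := hzw
  rw [hs, ht] at hnorm
  have hst : s * t = 1 := by linarith
  have hs1 : s = 1 ∨ s = -1 := Int.isUnit_iff.1 (IsUnit.of_mul_eq_one t hst)
  set U' : ℝ := ((x : ℝ) - y * √(d : ℝ)) / 2 with hU'
  have hUU : U * U' = s := by
    rw [hu, hU']
    have : ((x : ℝ) ^ 2 - d * y ^ 2) = 4 * s := by exact_mod_cast hs
    linear_combination (1 / 4) * this - (1 / 4) * (y : ℝ) ^ 2 * hsq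
  have habs : |U * U'| = 1 := by
    rw [hUU]; rcases hs1 with rfl | rfl <;> simp
  have hU'le : |U'| ≤ 1 := by
    rw [abs_mul, abs_of_pos (by linarith : 0 < U)] at habs
    nlinarith [abs_nonneg U']
  have hdiff : U - U' = y * √(d : ℝ) := by rw [hu, hU']; ring
  obtain ⟨hl, hr⟩ := abs_le.1 hU'le
  by_cases hy : y = 0
  · rw [hy] at hdiff
    have : U = U' := by simpa [sub_eq_zero] using hdiff
    linarith
  · have hy1 : (1 : ℝ) ≤ y ^ 2 := by
      have : 0 < y ^ 2 := by positivity
      exact_mod_cast this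
    have hge : (5 : ℝ) ≤ (U - U') ^ 2 := by
      rw [hdiff, mul_pow, sq √(d : ℝ), hsq]
      nlinarith
    nlinarith

theorem exists_unit_gt_one {d : ℕ} (hd : IsQuadraticDiscriminant d) :
    ∃ u : (quadOrder d)ˣ, 1 < ((u : quadOrder d) : ℝ) := by
  have hd5 := hd.five_le
  have hns : ¬ IsSquare (d : ℤ) := by
    rintro ⟨r, hr⟩
    refine hd.1 ⟨r.natAbs, ?_⟩
    have := congrArg Int.natAbs hr
    simpa [Int.natAbs_mul] using this
  obtain ⟨x, y, hxy, hy⟩ := Pell.exists_of_not_isSquare (by omega : 0 < (d : ℤ)) hns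
  have hsq : √(d : ℝ) * √(d : ℝ) = d := Real.mul_self_sqrt (Nat.cast_nonneg d)
  have hd5' : (5 : ℝ) ≤ d := by exact_mod_cast hd5
  have hs1 : (1 : ℝ) < √(d : ℝ) := by
    rw [Real.lt_sqrt zero_le_one]; linarith
  have hm : ∀ p q : ℤ, (p : ℝ) + q * √(d : ℝ) ∈ quadOrder d := fun p q =>
    add_mem (intCast_mem _ _) (mul_mem (intCast_mem _ _) (sqrt_mem_quadOrder d))
  have hxy' : ((|x| : ℤ) : ℝ) ^ 2 - d * ((|y| : ℤ) : ℝ) ^ 2 = 1 := by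
    have : |x| ^ 2 - (d : ℤ) * |y| ^ 2 = 1 := by rw [sq_abs, sq_abs]; exact hxy
    exact_mod_cast this
  refine ⟨⟨⟨_, hm |x| |y|⟩, ⟨_, hm |x| (-|y|)⟩, ?_, ?_⟩, ?_⟩
  · apply Subtype.ext
    change (((|x| : ℤ) : ℝ) + ((|y| : ℤ) : ℝ) * √(d : ℝ)) *
      (((|x| : ℤ) : ℝ) + ((-|y| : ℤ) : ℝ) * √(d : ℝ)) = 1
    rw [Int.cast_neg]
    linear_combination hxy' - ((|y| : ℤ) : ℝ) ^ 2 * hsq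
  · apply Subtype.ext
    change (((|x| : ℤ) : ℝ) + ((-|y| : ℤ) : ℝ) * √(d : ℝ)) *
      (((|x| : ℤ) : ℝ) + ((|y| : ℤ) : ℝ) * √(d : ℝ)) = 1
    rw [Int.cast_neg]
    linear_combination hxy' - ((|y| : ℤ) : ℝ) ^ 2 * hsq
  · change 1 < ((|x| : ℤ) : ℝ) + ((|y| : ℤ) : ℝ) * √(d : ℝ)
    have hx0 : (0 : ℝ) ≤ ((|x| : ℤ) : ℝ) := by exact_mod_cast abs_nonneg x
    have hy1 : (1 : ℝ) ≤ ((|y| : ℤ) : ℝ) := by exact_mod_cast Int.one_le_abs hy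
    nlinarith

theorem coe_unit_zpow {d : ℕ} (ξ : (quadOrder d)ˣ) (k : ℤ) :
    (((ξ ^ k : (quadOrder d)ˣ) : quadOrder d) : ℝ) = ((ξ : quadOrder d) : ℝ) ^ k := by
  have h := map_zpow (Units.map ((quadOrder d).val : quadOrder d →* ℝ)) ξ k
  have h2 := congrArg (fun t : ℝˣ => (t : ℝ)) h
  rw [Units.val_zpow_eq_zpow_val] at h2
  exact h2

theorem exists_isFundamentalUnit {d : ℕ} (hd : IsQuadraticDiscriminant d) :
    ∃ ξ : (quadOrder d)ˣ, IsFundamentalUnit ξ := by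
  have hne : ∀ u : (quadOrder d)ˣ, ((u : quadOrder d) : ℝ) ≠ 0 := fun u h => by
    exact u.ne_zero (Subtype.ext h)
  -- The group of logarithms of absolute values of units is discrete.
  let H : AddSubgroup ℝ :=
    { carrier := {t | ∃ u : (quadOrder d)ˣ, t = Real.log ((u : quadOrder d) : ℝ)}
      zero_mem' := ⟨1, by simp⟩
      add_mem' := by
        rintro _ _ ⟨u, rfl⟩ ⟨v, rfl⟩
        exact ⟨u * v, by simp [Real.log_mul (hne u) (hne v)]⟩
      neg_mem' := by
        rintro _ ⟨u, rfl⟩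
        refine ⟨u⁻¹, ?_⟩
        have h := coe_unit_zpow u (-1)
        rw [zpow_neg_one, zpow_neg_one] at h
        rw [h, Real.log_inv] }
  have hpos : ∀ u : (quadOrder d)ˣ, ∃ v : (quadOrder d)ˣ, (v = u ∨ v = -u) ∧
      0 < ((v : quadOrder d) : ℝ) ∧
      Real.log ((v : quadOrder d) : ℝ) = Real.log ((u : quadOrder d) : ℝ) := by
    intro u
    rcases lt_or_gt_of_ne (hne u) with h | h
    · exact ⟨-u, Or.inr rfl, by simpa using h, by simp⟩
    · exact ⟨u, Or.inl rfl, h, rfl⟩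
  have hgap : Disjoint (H : Set ℝ) (Set.Ioo 0 (Real.log (11 / 10))) := by
    rw [Set.disjoint_left]
    rintro _ ⟨u, rfl⟩ ⟨h0, h1⟩
    obtain ⟨v, -, hv0, hv⟩ := hpos u
    rw [← hv] at h0 h1
    have h2 := quadOrder_unit_gap hd v ((Real.log_pos_iff hv0.le).1 h0)
    exact absurd (Real.log_le_log (by norm_num) h2) (not_le.2 h1)
  obtain ⟨b, hb⟩ := AddSubgroup.cyclic_of_isolated_zero (Real.log_pos (by norm_num)) hgap
  have hmem : ∀ u : (quadOrder d)ˣ, ∃ k : ℤ, k • b = Real.log ((u : quadOrder d) : ℝ) := by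
    intro u
    have : Real.log ((u : quadOrder d) : ℝ) ∈ H := ⟨u, rfl⟩
    rw [hb] at this
    exact AddSubgroup.mem_closure_singleton.1 this
  obtain ⟨u₀, hu₀⟩ : b ∈ H := by
    rw [hb]; exact AddSubgroup.mem_closure_singleton.2 ⟨1, one_zsmul b⟩
  have hb0 : b ≠ 0 := by
    rintro rfl
    obtain ⟨u, hu⟩ := exists_unit_gt_one hd
    obtain ⟨k, hk⟩ := hmem u
    rw [smul_zero] at hk
    exact (Real.log_pos hu).ne hk
  -- A generator with positive logarithm.
  obtain ⟨u₁, hu₁, hgen⟩ : ∃ u₁ : (quadOrder d)ˣ, 0 < Real.log ((u₁ : quadOrder d) : ℝ) ∧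
      ∀ u : (quadOrder d)ˣ, ∃ k : ℤ,
        k * Real.log ((u₁ : quadOrder d) : ℝ) = Real.log ((u : quadOrder d) : ℝ) := by
    rcases lt_or_gt_of_ne hb0 with h | h
    · have hi : Real.log (((u₀⁻¹ : (quadOrder d)ˣ) : quadOrder d) : ℝ) = -b := by
        have h := coe_unit_zpow u₀ (-1)
        rw [zpow_neg_one, zpow_neg_one] at h
        rw [h, Real.log_inv, hu₀]
      refine ⟨u₀⁻¹, by rw [hi]; linarith, fun u => ?_⟩
      obtain ⟨k, hk⟩ := hmem u
      refine ⟨-k, ?_⟩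
      rw [hi, ← hk, zsmul_eq_mul]
      push_cast; ring
    · refine ⟨u₀, by rw [← hu₀]; exact h, fun u => ?_⟩
      obtain ⟨k, hk⟩ := hmem u
      exact ⟨k, by rw [← hu₀, ← hk, zsmul_eq_mul]⟩
  obtain ⟨ξ, -, hξ0, hξ⟩ := hpos u₁
  refine ⟨ξ, (Real.log_pos_iff hξ0.le).1 (by rw [hξ]; exact hu₁), fun u => ?_⟩
  obtain ⟨v, hv, hv0, hvl⟩ := hpos u
  obtain ⟨k, hk⟩ := hgen u
  have hvk : v = ξ ^ k := by
    apply Units.ext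
    apply Subtype.ext
    rw [coe_unit_zpow]
    apply Real.log_injOn_pos (Set.mem_Ioi.2 hv0) (Set.mem_Ioi.2 (zpow_pos hξ0 k))
    rw [Real.log_zpow, hξ, hk, hvl]
  refine ⟨k, ?_⟩
  rcases hv with rfl | rfl
  · exact Or.inl hvk
  · right
    rw [← hvk, neg_neg]

/-- The fundamental unit `ξ_d > 1` of the order of discriminant `d`. -/
def fundamentalUnit {d : ℕ} (hd : IsQuadraticDiscriminant d) : (quadOrder d)ˣ :=
  (exists_isFundamentalUnit hd).choose

theorem fundamentalUnit_spec {d : ℕ} (hd : IsQuadraticDiscriminant d) :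
    IsFundamentalUnit (fundamentalUnit hd) :=
  (exists_isFundamentalUnit hd).choose_spec

end

/-! Write the order as ℤ[ω] with ω² = e + rω and r² + 4e = d, and let αᵢ generate the ideal of norm
nᵢ. The number log|z/z*| is additive in z, and multiplying z by ξ shifts it by 2 log ξ. So the
products ∏ αᵢ^kᵢ with 0 ≤ kᵢ ≤ K give (K+1)^m points on a circle of length 2 log ξ.

These points repel each other. If z and w have norm at most X and are not rational multiples of one
another, then v = z w* differs from v* by a nonzero integer times √d, so one of |v|, |v*| is at
least √d/2, while |v v*| ≤ X²; hence |log|v/v*|| ≥ 2 log(√d/2) − 2 log X (`le_abs_logRatio_sub`).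
With K a small multiple of log √d this gap is still at least (log √d)/2, and counting points
(`card_mul_le_of_separated`) gives log ξ ≫ K^m log √d.

Non-proportionality is arithmetic (`IsSplitFamily.im_mul_star_ne_zero`). A prime pᵢ ∣ nᵢ' is prime
to d and to the norms of the other generators, and αᵢ is primitive at pᵢ, hence so are all its
powers; the exponent of αᵢ can therefore be read off up to rational factors and units. -/

namespace QuadraticAlgebra

/-! ### Divisibility by rational primes in ℤ[ω]; exponents of split primes. -/

variable {e r : ℤ}

theorem trace_sq_sub_four_mul_norm (z : QuadraticAlgebra ℤ e r) :
    trace z ^ 2 - 4 * norm z = (r ^ 2 + 4 * e) * z.im ^ 2 := by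
  rw [trace_def, norm_def]; ring

theorem intCast_dvd_iff {p : ℤ} {z : QuadraticAlgebra ℤ e r} :
    (p : QuadraticAlgebra ℤ e r) ∣ z ↔ p ∣ z.re ∧ p ∣ z.im := by
  have := algebraMap_dvd_iff (r := p) (z := z)
  simpa using this

theorem intCast_dvd_intCast_mul {p t : ℤ} (hp : Prime p) (ht : ¬ p ∣ t)
    {z : QuadraticAlgebra ℤ e r} (h : (p : QuadraticAlgebra ℤ e r) ∣ t * z) :
    (p : QuadraticAlgebra ℤ e r) ∣ z := by
  rw [intCast_dvd_iff] at h ⊢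
  simp only [re_mul, im_mul, re_intCast, im_intCast, mul_zero, zero_mul, add_zero, Int.cast_id] at h
  exact ⟨(hp.dvd_or_dvd h.1).resolve_left ht, (hp.dvd_or_dvd h.2).resolve_left ht⟩

theorem intCast_norm (z : QuadraticAlgebra ℤ e r) :
    ((norm z : ℤ) : QuadraticAlgebra ℤ e r) = z * star z := by
  rw [← algebraMap_norm_eq_mul_star]; rfl

/-- Otherwise tr² − 4N = D·im² forces p ∣ im, and then N forces p ∣ re. This route also covers p =
2. -/
theorem not_dvd_trace {p : ℤ} (hp : Prime p) (hD : ¬ p ∣ r ^ 2 + 4 * e)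
    {z : QuadraticAlgebra ℤ e r} (hz : ¬ (p : QuadraticAlgebra ℤ e r) ∣ z) (hN : p ∣ norm z) :
    ¬ p ∣ trace z := by
  intro ht
  have h1 : p ∣ (r ^ 2 + 4 * e) * z.im ^ 2 := by
    rw [← trace_sq_sub_four_mul_norm]
    exact dvd_sub (ht.trans (dvd_pow_self _ two_ne_zero)) (hN.mul_left 4)
  have him : p ∣ z.im := hp.dvd_of_dvd_pow ((hp.dvd_or_dvd h1).resolve_left hD)
  have h2 : p ∣ z.re ^ 2 := by
    have h : z.re ^ 2 = norm z - z.im * (r * z.re - e * z.im) := by rw [norm_def]; ring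
    rw [h]
    exact dvd_sub hN (him.mul_right _)
  exact hz (intCast_dvd_iff.2 ⟨hp.dvd_of_dvd_pow h2, him⟩)

/-- Since p ∣ N(z), z² ≡ tr(z) z mod p, hence z^(k+1) ≡ tr(z)^k z, and tr(z) is invertible mod p. -/
theorem not_intCast_dvd_pow {p : ℤ} (hp : Prime p) (hD : ¬ p ∣ r ^ 2 + 4 * e)
    {z : QuadraticAlgebra ℤ e r} (hz : ¬ (p : QuadraticAlgebra ℤ e r) ∣ z) (hN : p ∣ norm z)
    (k : ℕ) : ¬ (p : QuadraticAlgebra ℤ e r) ∣ z ^ k := by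
  have ht := not_dvd_trace hp hD hz hN
  have hcongr : ∀ k : ℕ, (p : QuadraticAlgebra ℤ e r) ∣ z ^ (k + 1) - (trace z : ℤ) ^ k * z := by
    intro k
    induction k with
    | zero => simp
    | succ k ih =>
      have hsq : z ^ 2 = (trace z : ℤ) * z - ((norm z : ℤ) : QuadraticAlgebra ℤ e r) := by
        have h := sq_eq_trace_smul_sub_norm z
        rw [h, zsmul_eq_mul]; rfl
      have h : z ^ (k + 1 + 1) - (trace z : ℤ) ^ (k + 1) * z =
          z * (z ^ (k + 1) - (trace z : ℤ) ^ k * z)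
            - (trace z : ℤ) ^ k * ((norm z : ℤ) : QuadraticAlgebra ℤ e r) := by
        linear_combination ((trace z : ℤ) : QuadraticAlgebra ℤ e r) ^ k * hsq
      rw [h]
      exact dvd_sub (ih.mul_left _) ((Int.cast_dvd_cast _ _ hN).mul_left _)
  cases k with
  | zero =>
    rw [pow_zero, intCast_dvd_iff]
    exact fun h => hp.not_dvd_one h.1
  | succ k =>
    intro h
    have h2 := (dvd_sub_right h).1 (hcongr k)
    rw [← Int.cast_pow] at h2
    exact hz (intCast_dvd_intCast_mul hp (fun h3 => ht (hp.dvd_of_dvd_pow h3)) h2)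

theorem intCast_dvd_of_dvd_mul {p : ℤ} (hp : Prime p) {z w : QuadraticAlgebra ℤ e r}
    (hw : ¬ p ∣ norm w) (h : (p : QuadraticAlgebra ℤ e r) ∣ z * w) :
    (p : QuadraticAlgebra ℤ e r) ∣ z := by
  refine intCast_dvd_intCast_mul hp hw ?_
  rw [intCast_norm]
  have : w * star w * z = z * w * star w := by ring
  rw [this]
  exact h.mul_right _

/-- If z w* is a rational integer c, then N(w) z = c w; dividing by the gcd makes the coefficients
coprime, as needed to transfer p ∣ a into p ∤ b. -/
theorem exists_isCoprime_of_im_mul_star_eq_zero {z w : QuadraticAlgebra ℤ e r} (hw : norm w ≠ 0)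
    (h : (z * star w).im = 0) :
    ∃ a b : ℤ, IsCoprime a b ∧ (b : QuadraticAlgebra ℤ e r) * z = a * w := by
  obtain ⟨c, hc⟩ : ∃ c : ℤ, z * star w = (c : QuadraticAlgebra ℤ e r) :=
    ⟨(z * star w).re, by ext <;> simp [h]⟩
  have h1 : ((norm w : ℤ) : QuadraticAlgebra ℤ e r) * z = c * w := by
    rw [intCast_norm, ← hc]; ring
  have hg : 0 < Int.gcd c (norm w) := Int.gcd_pos_of_ne_zero_right _ hw
  obtain ⟨a, b, hab, ha, hb⟩ := Int.exists_gcd_one hg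
  refine ⟨a, b, Int.isCoprime_iff_gcd_eq_one.2 hab, ?_⟩
  have hg0 : ((Int.gcd c (norm w) : ℕ) : ℤ) ≠ 0 := by exact_mod_cast hg.ne'
  generalize ((Int.gcd c (norm w) : ℕ) : ℤ) = g at ha hb hg0
  rw [hb, ha] at h1
  have hre := congrArg re h1
  have him := congrArg im h1
  simp only [re_mul, im_mul, re_intCast, im_intCast, mul_zero, zero_mul, add_zero, Int.cast_id]
    at hre him
  ext
  · simp only [re_mul, re_intCast, im_intCast, mul_zero, zero_mul, add_zero, Int.cast_id]
    exact mul_right_cancel₀ hg0 (by linear_combination hre)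
  · simp only [im_mul, re_intCast, im_intCast, mul_zero, zero_mul, add_zero, Int.cast_id]
    exact mul_right_cancel₀ hg0 (by linear_combination him)

/-- Comparing the exact powers of a split prime: a power of a primitive element `z` cannot be
cancelled by rational factors and elements of norm prime to `p`. -/
theorem false_of_intCast_mul_pow_eq {p : ℤ} (hp : Prime p) (hD : ¬ p ∣ r ^ 2 + 4 * e)
    {z x y : QuadraticAlgebra ℤ e r} (hz : ¬ (p : QuadraticAlgebra ℤ e r) ∣ z) (hN : p ∣ norm z)
    (hx : ¬ p ∣ norm x) (hy : ¬ p ∣ norm y) {a b : ℤ} (hab : IsCoprime a b) {k : ℕ} (hk : k ≠ 0)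
    (h : (b : QuadraticAlgebra ℤ e r) * (z ^ k * x) = a * y) : False := by
  have hn := congrArg norm h
  simp only [map_mul, map_pow, norm_intCast, Int.cast_id] at hn
  -- On norms, p divides the left side because k ≠ 0, and the right side can absorb it only through
  -- a².
  have ha : p ∣ a := by
    have h1 : p ∣ a ^ 2 * norm y := by
      have h2 : p ∣ norm z ^ k := hN.trans (dvd_pow_self _ hk)
      rw [← hn]
      exact (h2.mul_right _).mul_left _
    exact hp.dvd_of_dvd_pow ((hp.dvd_or_dvd h1).resolve_right hy)
  have hb : ¬ p ∣ b := fun hb => hp.not_isUnit (hab.isUnit_of_dvd' ha hb)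
  have h1 : (p : QuadraticAlgebra ℤ e r) ∣ b * (z ^ k * x) := by
    rw [h]
    exact (Int.cast_dvd_cast _ _ ha).mul_right _
  exact not_intCast_dvd_pow hp hD hz hN k
    (intCast_dvd_of_dvd_mul hp hx (intCast_dvd_intCast_mul hp hb h1))

/-- Elements whose norms are separated by primes not dividing the discriminant. -/
structure IsSplitFamily {ι : Type*} (α : ι → QuadraticAlgebra ℤ e r) (p : ι → ℤ) : Prop where
  prime : ∀ i, Prime (p i)
  not_dvd_disc : ∀ i, ¬ p i ∣ r ^ 2 + 4 * e
  not_dvd : ∀ i, ¬ ((p i : ℤ) : QuadraticAlgebra ℤ e r) ∣ α i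
  dvd_norm : ∀ i, p i ∣ norm (α i)
  not_dvd_norm : ∀ i j, i ≠ j → ¬ p i ∣ norm (α j)

theorem IsSplitFamily.le_of_eq {ι : Type*} [Fintype ι] {α : ι → QuadraticAlgebra ℤ e r}
    {p : ι → ℤ} (hα : IsSplitFamily α p) {k l : ι → ℕ} {u : (QuadraticAlgebra ℤ e r)ˣ} {a b : ℤ}
    (hab : IsCoprime a b) (hαi : ∀ i, norm (α i) ≠ 0)
    (h : (b : QuadraticAlgebra ℤ e r) * ∏ i, α i ^ k i = a * ((∏ i, α i ^ l i) * u)) (i : ι) :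
    k i ≤ l i := by
  classical
  -- If k i exceeded l i, cancelling α i ^ l i would leave a positive power of α i on one side, with
  -- every other non-rational factor of norm prime to p i.
  by_contra! hlt
  have hp := hα.prime i
  have hprod : ∀ k : ι → ℕ, ¬ p i ∣ norm (∏ j ∈ Finset.univ.erase i, α j ^ k j) := by
    intro k hk
    rw [map_prod] at hk
    obtain ⟨j, hj, hj'⟩ := hp.exists_mem_finset_dvd hk
    rw [map_pow] at hj'
    exact hα.not_dvd_norm i j (Finset.ne_of_mem_erase hj).symm (hp.dvd_of_dvd_pow hj')
  have hu : IsUnit (norm (u : QuadraticAlgebra ℤ e r)) := u.isUnit.map norm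
  refine false_of_intCast_mul_pow_eq hp (hα.not_dvd_disc i) (hα.not_dvd i) (hα.dvd_norm i)
    (hprod k) (y := (∏ j ∈ Finset.univ.erase i, α j ^ l j) * u) ?_ hab
    (Nat.sub_ne_zero_of_lt hlt) ?_
  · rw [map_mul, hu.dvd_mul_right]
    exact hprod l
  · have hreg : α i ^ l i ∈ nonZeroDivisors (QuadraticAlgebra ℤ e r) :=
      pow_mem (norm_mem_nonZeroDivisors_iff.1 (mem_nonZeroDivisors_of_ne_zero (hαi i))) _
    rw [← Finset.mul_prod_erase _ _ (Finset.mem_univ i),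
      ← Finset.mul_prod_erase _ _ (Finset.mem_univ i), ← Nat.sub_add_cancel hlt.le, pow_add] at h
    refine (mul_cancel_left_mem_nonZeroDivisors hreg).1 ?_
    linear_combination h

theorem IsSplitFamily.im_mul_star_ne_zero {ι : Type*} [Fintype ι]
    {α : ι → QuadraticAlgebra ℤ e r} {p : ι → ℤ} (hα : IsSplitFamily α p)
    (hαi : ∀ i, norm (α i) ≠ 0) {k l : ι → ℕ} (hkl : k ≠ l) (u : (QuadraticAlgebra ℤ e r)ˣ) :
    ((∏ i, α i ^ k i) * star ((∏ i, α i ^ l i) * (u : QuadraticAlgebra ℤ e r))).im ≠ 0 := by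
  intro h
  have hu : IsUnit (norm (u : QuadraticAlgebra ℤ e r)) := u.isUnit.map norm
  have hw : norm ((∏ i, α i ^ l i) * (u : QuadraticAlgebra ℤ e r)) ≠ 0 := by
    rw [map_mul, map_prod]
    refine mul_ne_zero (Finset.prod_ne_zero_iff.2 fun i _ => ?_) hu.ne_zero
    rw [map_pow]
    exact pow_ne_zero _ (hαi i)
  obtain ⟨a, b, hab, hE⟩ := exists_isCoprime_of_im_mul_star_eq_zero hw h
  -- The reverse inequality is the same statement with the two products exchanged and the unit
  -- carried across as u⁻¹.
  refine hkl (funext fun i => le_antisymm (hα.le_of_eq hab hαi hE i)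
    (hα.le_of_eq (u := u⁻¹) hab.symm hαi ?_ i))
  have huu : (u : QuadraticAlgebra ℤ e r) * ((u⁻¹ : (QuadraticAlgebra ℤ e r)ˣ)) = 1 := u.mul_inv
  linear_combination (-(a : QuadraticAlgebra ℤ e r) * ∏ i, α i ^ l i) * huu -
    ((u⁻¹ : (QuadraticAlgebra ℤ e r)ˣ) : QuadraticAlgebra ℤ e r) * hE

end QuadraticAlgebra

/-! ### Archimedean logarithms and the repulsion estimate. -/

namespace QuadraticAlgebra

variable {e r : ℤ}

/-- The ring homomorphism `x + y ω ↦ x + y (r + s) / 2`, where `s` is a square root of the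
discriminant. -/
noncomputable def realEmbedding (s : ℝ) (hs : s ^ 2 = r ^ 2 + 4 * e) :
    QuadraticAlgebra ℤ e r →ₐ[ℤ] ℝ :=
  lift ⟨((r : ℝ) + s) / 2, by
    simp only [zsmul_eq_mul]
    linear_combination (1 / 4 : ℝ) * hs⟩

variable {s : ℝ} (hs : s ^ 2 = r ^ 2 + 4 * e)

theorem realEmbedding_apply (z : QuadraticAlgebra ℤ e r) :
    realEmbedding s hs z = z.re + z.im * (((r : ℝ) + s) / 2) := by
  simp [realEmbedding]

theorem realEmbedding_sub_star (z : QuadraticAlgebra ℤ e r) :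
    realEmbedding s hs z - realEmbedding s hs (star z) = z.im * s := by
  simp only [realEmbedding_apply, re_star, im_star]
  push_cast
  ring

theorem realEmbedding_mul_star (z : QuadraticAlgebra ℤ e r) :
    realEmbedding s hs z * realEmbedding s hs (star z) = (norm z : ℤ) := by
  rw [← map_mul, ← intCast_norm, map_intCast]

theorem realEmbedding_ne_zero {z : QuadraticAlgebra ℤ e r} (hz : norm z ≠ 0) :
    realEmbedding s hs z ≠ 0 := by
  intro h
  have := realEmbedding_mul_star hs z
  rw [h, zero_mul] at this
  exact hz (by exact_mod_cast this.symm)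

theorem realEmbedding_star_ne_zero {z : QuadraticAlgebra ℤ e r} (hz : norm z ≠ 0) :
    realEmbedding s hs (star z) ≠ 0 :=
  realEmbedding_ne_zero hs (by rwa [norm_star])

/-- The logarithm of the quotient of the two archimedean absolute values. -/
noncomputable def logRatio (z : QuadraticAlgebra ℤ e r) : ℝ :=
  Real.log (realEmbedding s hs z) - Real.log (realEmbedding s hs (star z))

theorem logRatio_star (z : QuadraticAlgebra ℤ e r) : logRatio hs (star z) = -logRatio hs z := by
  simp [logRatio]

theorem logRatio_mul {z w : QuadraticAlgebra ℤ e r} (hz : norm z ≠ 0) (hw : norm w ≠ 0) :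
    logRatio hs (z * w) = logRatio hs z + logRatio hs w := by
  rw [logRatio, star_mul', map_mul, map_mul, Real.log_mul (realEmbedding_ne_zero hs hz)
    (realEmbedding_ne_zero hs hw), Real.log_mul (realEmbedding_star_ne_zero hs hz)
    (realEmbedding_star_ne_zero hs hw), logRatio, logRatio]
  ring

theorem norm_units_ne_zero (u : (QuadraticAlgebra ℤ e r)ˣ) :
    norm (u : QuadraticAlgebra ℤ e r) ≠ 0 := (u.isUnit.map norm).ne_zero

theorem abs_norm_unit (u : (QuadraticAlgebra ℤ e r)ˣ) :
    |norm (u : QuadraticAlgebra ℤ e r)| = 1 := Int.isUnit_iff_abs_eq.1 (u.isUnit.map norm)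

/-- `Real.log` sees only absolute values, and |u u*| = 1, so the conjugate contributes the same
amount again. -/
theorem logRatio_unit (u : (QuadraticAlgebra ℤ e r)ˣ) :
    logRatio hs (u : QuadraticAlgebra ℤ e r) =
      2 * Real.log (realEmbedding s hs (u : QuadraticAlgebra ℤ e r)) := by
  have h := congrArg Real.log (realEmbedding_mul_star hs (u : QuadraticAlgebra ℤ e r))
  rw [Real.log_mul (realEmbedding_ne_zero hs (norm_units_ne_zero u))
    (realEmbedding_star_ne_zero hs (norm_units_ne_zero u)), ← Real.log_abs ((norm _ : ℤ) : ℝ),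
    ← Int.cast_abs, abs_norm_unit, Int.cast_one, Real.log_one] at h
  rw [logRatio]
  linarith

theorem realEmbedding_zpow (u : (QuadraticAlgebra ℤ e r)ˣ) (j : ℤ) :
    realEmbedding s hs ((u ^ j : (QuadraticAlgebra ℤ e r)ˣ) : QuadraticAlgebra ℤ e r) =
      realEmbedding s hs (u : QuadraticAlgebra ℤ e r) ^ j := by
  have h := map_zpow (Units.map (realEmbedding s hs : QuadraticAlgebra ℤ e r →* ℝ)) u j
  have h2 := congrArg (fun t : ℝˣ => (t : ℝ)) h
  rw [Units.val_zpow_eq_zpow_val] at h2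
  exact h2

theorem logRatio_zpow (u : (QuadraticAlgebra ℤ e r)ˣ) (j : ℤ) :
    logRatio hs ((u ^ j : (QuadraticAlgebra ℤ e r)ˣ) : QuadraticAlgebra ℤ e r) =
      j * logRatio hs (u : QuadraticAlgebra ℤ e r) := by
  rw [logRatio_unit, logRatio_unit, realEmbedding_zpow, Real.log_zpow]
  ring

/-- A rational power u^j would equal its conjugate and have log ratio 0, but that ratio is 2j log u.
-/
theorem im_zpow_ne_zero {u : (QuadraticAlgebra ℤ e r)ˣ}
    (hu : 1 < realEmbedding s hs (u : QuadraticAlgebra ℤ e r)) {j : ℤ} (hj : j ≠ 0) :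
    ((u ^ j : (QuadraticAlgebra ℤ e r)ˣ) : QuadraticAlgebra ℤ e r).im ≠ 0 := by
  intro h
  have h1 := realEmbedding_sub_star hs ((u ^ j : (QuadraticAlgebra ℤ e r)ˣ) : QuadraticAlgebra ℤ e r)
  rw [h, Int.cast_zero, zero_mul, sub_eq_zero] at h1
  have h2 := logRatio_zpow hs u j
  rw [logRatio, ← h1, sub_self, logRatio_unit] at h2
  have h3 := Real.log_pos hu
  have hj' : (j : ℝ) ≠ 0 := by exact_mod_cast hj
  exact (mul_ne_zero hj' (by positivity)) h2.symm

/-- Elements of small norm which are not rationally proportional are well separated. -/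
theorem le_abs_logRatio_sub (hs0 : 0 < s) {z w : QuadraticAlgebra ℤ e r} {X : ℝ}
    (hz : norm z ≠ 0) (hw : norm w ≠ 0) (hzX : |((norm z : ℤ) : ℝ)| ≤ X)
    (hwX : |((norm w : ℤ) : ℝ)| ≤ X) (him : (z * star w).im ≠ 0) :
    2 * Real.log (s / 2) - 2 * Real.log X ≤ |logRatio hs z - logRatio hs w| := by
  set v := z * star w with hv
  have hw' : norm (star w) ≠ 0 := by rwa [norm_star]
  have hv0 : norm v ≠ 0 := by rw [hv, map_mul]; exact mul_ne_zero hz hw'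
  have hvlog : logRatio hs z - logRatio hs w = logRatio hs v := by
    rw [hv, logRatio_mul hs hz hw', logRatio_star]; ring
  have hX : 0 < X := lt_of_lt_of_le (by rw [abs_pos]; exact_mod_cast hz) hzX
  have hprod : Real.log (realEmbedding s hs v) + Real.log (realEmbedding s hs (star v)) ≤
      2 * Real.log X := by
    rw [← Real.log_mul (realEmbedding_ne_zero hs hv0) (realEmbedding_star_ne_zero hs hv0),
      realEmbedding_mul_star, ← Real.log_abs, ← Nat.cast_ofNat, ← Real.log_pow]
    refine Real.log_le_log (by rw [abs_pos]; exact_mod_cast hv0) ?_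
    rw [hv, map_mul, norm_star, Int.cast_mul, abs_mul, sq]
    exact mul_le_mul hzX hwX (abs_nonneg _) hX.le
  have hone : (1 : ℝ) ≤ |(v.im : ℝ)| := by exact_mod_cast Int.one_le_abs him
  -- Here v − v* = (im v) s with im v a nonzero integer. Whichever of v, v* has size at least s/2,
  -- the bound on log|v| + log|v*| turns this into a bound on their difference.
  have hsum : s ≤ |realEmbedding s hs v| + |realEmbedding s hs (star v)| := by
    refine le_trans ?_ (abs_sub _ _)
    rw [realEmbedding_sub_star, abs_mul, abs_of_pos hs0]
    nlinarith
  rw [hvlog, logRatio]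
  rcases le_total (s / 2) |realEmbedding s hs v| with h | h
  · have h1 := Real.log_le_log (half_pos hs0) h
    rw [Real.log_abs] at h1
    refine le_trans ?_ (le_abs_self _)
    linarith
  · have h1 := Real.log_le_log (half_pos hs0)
      (show s / 2 ≤ |realEmbedding s hs (star v)| by linarith)
    rw [Real.log_abs] at h1
    refine le_trans ?_ (neg_le_abs _)
    linarith

end QuadraticAlgebra

/-! ### Packing separated points on a circle. -/

/-- If the classes modulo `L` of finitely many real numbers are separated by at least `Δ`, and so
are the multiples of `L`, then there are at most `2 L / Δ` of them. -/
theorem card_mul_le_of_separated {ι : Type*} [Fintype ι] [Nonempty ι] {x : ι → ℝ} {L Δ : ℝ}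
    (hL : 0 < L) (hΔ : 0 < Δ)
    (h : ∀ i k, ∀ j : ℤ, i ≠ k ∨ j ≠ 0 → Δ ≤ |x i - (x k + j * L)|) :
    Fintype.card ι * Δ ≤ 2 * L := by
  -- Compare a point with its own translate by one period.
  have hLΔ : Δ ≤ L := by
    obtain ⟨i⟩ := ‹Nonempty ι›
    have := h i i 1 (Or.inr one_ne_zero)
    simpa [abs_of_pos hL] using this
  let t : ι → ℝ := fun i => Int.fract (x i / L) * L
  have ht0 : ∀ i, 0 ≤ t i := fun i => mul_nonneg (Int.fract_nonneg _) hL.le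
  have htL : ∀ i, t i ≤ L := fun i => by
    have := (Int.fract_lt_one (x i / L)).le
    exact mul_le_of_le_one_left hL.le this
  have ht : ∀ i, t i = x i - ⌊x i / L⌋ * L := fun i => by
    simp only [t, Int.fract, sub_mul, div_mul_cancel₀ _ hL.ne']
  -- Cut [0, L] into intervals of length Δ; separation allows at most one representative in each.
  -- The extra interval from rounding costs Δ ≤ L, whence the factor 2.
  have hmaps : ∀ i, ⌊t i / Δ⌋₊ ∈ Finset.range (⌊L / Δ⌋₊ + 1) := fun i => by
    rw [Finset.mem_range, Nat.lt_succ_iff]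
    exact Nat.floor_le_floor (div_le_div_of_nonneg_right (htL i) hΔ.le)
  have hinj : Function.Injective fun i => ⌊t i / Δ⌋₊ := by
    intro i k hik
    by_contra hne
    have h1 := h i k (⌊x i / L⌋ - ⌊x k / L⌋) (Or.inl hne)
    have h2 : x i - (x k + ((⌊x i / L⌋ - ⌊x k / L⌋ : ℤ) : ℝ) * L) = t i - t k := by
      rw [ht, ht]; push_cast; ring
    rw [h2] at h1
    have h3 : |t i / Δ - t k / Δ| < 1 := by
      have a1 := Nat.floor_le (div_nonneg (ht0 i) hΔ.le)
      have a2 := Nat.lt_floor_add_one (t i / Δ)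
      have b1 := Nat.floor_le (div_nonneg (ht0 k) hΔ.le)
      have b2 := Nat.lt_floor_add_one (t k / Δ)
      simp only at hik
      rw [hik] at a1 a2
      rw [abs_lt]
      constructor <;> linarith
    rw [← sub_div, abs_div, abs_of_pos hΔ, div_lt_one hΔ] at h3
    linarith
  have hcard : Fintype.card ι ≤ ⌊L / Δ⌋₊ + 1 := by
    rw [← Finset.card_range (⌊L / Δ⌋₊ + 1)]
    exact Finset.card_le_card_of_injOn _ (fun i _ => hmaps i) hinj.injOn
  have h4 : (Fintype.card ι : ℝ) ≤ L / Δ + 1 := by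
    have h5 : (Fintype.card ι : ℝ) ≤ (⌊L / Δ⌋₊ : ℝ) + 1 := by exact_mod_cast hcard
    linarith [Nat.floor_le (div_nonneg hL.le hΔ.le)]
  calc Fintype.card ι * Δ ≤ (L / Δ + 1) * Δ := by gcongr
    _ = L + Δ := by field_simp
    _ ≤ 2 * L := by linarith

/-! ### Counting products of generators modulo units. -/

namespace QuadraticAlgebra

variable {e r : ℤ} {s : ℝ} (hs : s ^ 2 = r ^ 2 + 4 * e)

/-- The unit bound for a split family, with a cut-off `K` for the exponents. -/
theorem IsSplitFamily.pow_mul_le_log_unit {ι : Type*} [Fintype ι]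
    {α : ι → QuadraticAlgebra ℤ e r} {p : ι → ℤ} (hα : IsSplitFamily α p)
    (hαi : ∀ i, norm (α i) ≠ 0) (hs0 : 0 < s) {u : (QuadraticAlgebra ℤ e r)ˣ}
    (hu : 1 < realEmbedding s hs (u : QuadraticAlgebra ℤ e r)) {K : ℕ} {Δ : ℝ} (hΔ : 0 < Δ)
    (hΔK : Δ ≤ 2 * Real.log (s / 2) - 2 * Real.log (∏ i, |((norm (α i) : ℤ) : ℝ)| ^ K)) :
    ((K : ℝ) + 1) ^ Fintype.card ι * Δ ≤
      4 * Real.log (realEmbedding s hs (u : QuadraticAlgebra ℤ e r)) := by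
  classical
  let z : (ι → Fin (K + 1)) → QuadraticAlgebra ℤ e r := fun k => ∏ i, α i ^ (k i : ℕ)
  have hz0 : ∀ k, norm (z k) ≠ 0 := fun k => by
    simp only [z, map_prod, map_pow]
    exact Finset.prod_ne_zero_iff.2 fun i _ => pow_ne_zero _ (hαi i)
  have hzX : ∀ k, |((norm (z k) : ℤ) : ℝ)| ≤ ∏ i, |((norm (α i) : ℤ) : ℝ)| ^ K := fun k => by
    simp only [z, map_prod, map_pow, Int.cast_prod, Int.cast_pow, Finset.abs_prod, abs_pow]
    refine Finset.prod_le_prod (fun i _ => by positivity) fun i _ => ?_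
    refine pow_le_pow_right₀ ?_ (Nat.lt_succ_iff.1 (k i).2)
    exact_mod_cast Int.one_le_abs (hαi i)
  have hL : 0 < logRatio hs (u : QuadraticAlgebra ℤ e r) := by
    rw [logRatio_unit]
    have := Real.log_pos hu
    positivity
  have hmain := card_mul_le_of_separated (x := fun k => logRatio hs (z k)) hL hΔ ?_
  · rw [logRatio_unit, Fintype.card_fun, Fintype.card_fin] at hmain
    push_cast at hmain
    linarith
  intro k l j hkl
  have hw0 : norm (z l * ((u ^ j : (QuadraticAlgebra ℤ e r)ˣ) : QuadraticAlgebra ℤ e r)) ≠ 0 := by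
    rw [map_mul]
    exact mul_ne_zero (hz0 l) (norm_units_ne_zero _)
  rw [← logRatio_zpow, ← logRatio_mul hs (hz0 l) (norm_units_ne_zero _)]
  refine hΔK.trans (le_abs_logRatio_sub hs hs0 (hz0 k) hw0 (hzX k) ?_ ?_)
  · rw [← Int.cast_abs, map_mul, abs_mul, abs_norm_unit, mul_one, Int.cast_abs]
    exact hzX l
  -- For equal exponents the two elements differ by u^j with j ≠ 0, which is irrational; for
  -- distinct exponents the split primes apply.
  · by_cases h : k = l
    · subst h
      have hj : j ≠ 0 := hkl.resolve_left (not_not_intro rfl)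
      have h1 : z k * star (z k * ((u ^ j : (QuadraticAlgebra ℤ e r)ˣ) : QuadraticAlgebra ℤ e r)) =
          ((norm (z k) : ℤ) : QuadraticAlgebra ℤ e r) *
            star ((u ^ j : (QuadraticAlgebra ℤ e r)ˣ) : QuadraticAlgebra ℤ e r) := by
        rw [star_mul', ← mul_assoc, ← intCast_norm]
      rw [h1]
      simp only [im_mul, im_star, re_intCast, im_intCast, zero_mul, mul_zero, add_zero, Int.cast_id]
      exact mul_ne_zero (hz0 k) (neg_ne_zero.2 (im_zpow_ne_zero hs hu hj))
    · refine hα.im_mul_star_ne_zero hαi (fun h2 => h ?_) _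
      exact funext fun i => Fin.ext (congrFun h2 i)

end QuadraticAlgebra

/-! ### The order of discriminant d and its reduced principal ideals. -/

namespace IsQuadraticDiscriminant

open QuadraticAlgebra

variable {d : ℕ}

theorem sqrt_sq_eq (hd : IsQuadraticDiscriminant d) :
    √(d : ℝ) ^ 2 = (((d % 2 : ℕ) : ℤ) : ℝ) ^ 2 + 4 * (((d / 4 : ℕ) : ℤ) : ℝ) := by
  have h := hd.2
  rw [Real.sq_sqrt (Nat.cast_nonneg d)]
  have h1 : d = (d % 2) ^ 2 + 4 * (d / 4) := by
    rcases h with h | h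
    · have h2 : d % 2 = 0 := by omega
      rw [h2]; omega
    · have h2 : d % 2 = 1 := by omega
      rw [h2]; omega
  exact_mod_cast congrArg (fun t : ℕ => (t : ℝ)) h1

theorem disc_eq (hd : IsQuadraticDiscriminant d) :
    ((d % 2 : ℕ) : ℤ) ^ 2 + 4 * ((d / 4 : ℕ) : ℤ) = d := by
  have h := hd.sqrt_sq_eq
  rw [Real.sq_sqrt (Nat.cast_nonneg d)] at h
  exact_mod_cast h.symm

/-- The real embedding of the quadratic algebra of discriminant `d`. -/
noncomputable def embedding (hd : IsQuadraticDiscriminant d) :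
    QuadraticAlgebra ℤ ((d / 4 : ℕ) : ℤ) ((d % 2 : ℕ) : ℤ) →ₐ[ℤ] ℝ :=
  realEmbedding √(d : ℝ) hd.sqrt_sq_eq

theorem embedding_apply (hd : IsQuadraticDiscriminant d)
    (z : QuadraticAlgebra ℤ ((d / 4 : ℕ) : ℤ) ((d % 2 : ℕ) : ℤ)) :
    hd.embedding z = z.re + z.im * quadOmega d :=
  realEmbedding_apply _ _

theorem embedding_mem (hd : IsQuadraticDiscriminant d)
    (z : QuadraticAlgebra ℤ ((d / 4 : ℕ) : ℤ) ((d % 2 : ℕ) : ℤ)) :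
    hd.embedding z ∈ quadOrder d := by
  rw [embedding_apply]
  exact add_mem (intCast_mem _ _)
    (mul_mem (intCast_mem _ _) (Algebra.subset_adjoin (Set.mem_singleton _)))

theorem irrational_sqrt (hd : IsQuadraticDiscriminant d) : Irrational √(d : ℝ) :=
  irrational_sqrt_natCast_iff.2 hd.1

theorem eq_zero_of_add_mul_sqrt (hd : IsQuadraticDiscriminant d) {x y : ℤ}
    (h : (x : ℝ) + y * √(d : ℝ) = 0) : y = 0 := by
  by_contra hy
  exact ((hd.irrational_sqrt.intCast_mul hy).intCast_add x).ne_zero h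

theorem embedding_injective (hd : IsQuadraticDiscriminant d) :
    Function.Injective hd.embedding := by
  rw [injective_iff_map_eq_zero]
  intro z hz
  rw [embedding_apply, quadOmega] at hz
  have him : z.im = 0 := by
    refine hd.eq_zero_of_add_mul_sqrt (x := 2 * z.re + z.im * ((d % 2 : ℕ) : ℤ)) ?_
    simp only [Int.cast_add, Int.cast_mul, Int.cast_ofNat, Int.cast_natCast]
    linear_combination 2 * hz
  rw [him, Int.cast_zero, zero_mul, add_zero] at hz
  ext
  · exact_mod_cast hz
  · exact him

theorem exists_embedding_eq (hd : IsQuadraticDiscriminant d) {x : ℝ} (hx : x ∈ quadOrder d) :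
    ∃ z, hd.embedding z = x := by
  have hle : quadOrder d ≤ hd.embedding.range := by
    refine Algebra.adjoin_le ?_
    rintro _ rfl
    exact ⟨⟨0, 1⟩, (hd.embedding_apply _).trans (by simp)⟩
  exact hle hx

/-- The quadratic order of discriminant `d`, as a quadratic algebra over `ℤ`. -/
noncomputable def orderEquiv (hd : IsQuadraticDiscriminant d) :
    QuadraticAlgebra ℤ ((d / 4 : ℕ) : ℤ) ((d % 2 : ℕ) : ℤ) ≃ₐ[ℤ] quadOrder d :=
  AlgEquiv.ofBijective (hd.embedding.codRestrict (quadOrder d) hd.embedding_mem)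
    ⟨fun x y h => hd.embedding_injective (congrArg (fun t : quadOrder d => (t : ℝ)) h),
      fun x => by
        obtain ⟨z, hz⟩ := hd.exists_embedding_eq x.2
        exact ⟨z, Subtype.ext hz⟩⟩

theorem coe_orderEquiv (hd : IsQuadraticDiscriminant d)
    (z : QuadraticAlgebra ℤ ((d / 4 : ℕ) : ℤ) ((d % 2 : ℕ) : ℤ)) :
    (hd.orderEquiv z : ℝ) = hd.embedding z := rfl

/-- An ideal is killed by its norm. -/
theorem _root_.idealNorm_mem (I : Ideal (quadOrder d)) : (idealNorm I : quadOrder d) ∈ I := by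
  rw [← Ideal.Quotient.eq_zero_iff_mem, map_natCast, ← nsmul_one, idealNorm]
  exact card_nsmul_eq_zero'

/-- The ideal norm lies in the ideal, so it is a multiple of z; take norms. This and
`prime_dvd_norm` replace the equality of the ideal norm with |N(z)|. -/
theorem norm_dvd_sq_idealNorm (hd : IsQuadraticDiscriminant d) {I : Ideal (quadOrder d)}
    {z : QuadraticAlgebra ℤ ((d / 4 : ℕ) : ℤ) ((d % 2 : ℕ) : ℤ)}
    (hI : I = Ideal.span {hd.orderEquiv z}) : norm z ∣ (idealNorm I : ℤ) ^ 2 := by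
  have h := idealNorm_mem I
  obtain ⟨y, hy⟩ := Ideal.mem_span_singleton.1 (hI.le h)
  have h1 : ((idealNorm I : ℕ) : QuadraticAlgebra ℤ ((d / 4 : ℕ) : ℤ) ((d % 2 : ℕ) : ℤ)) =
      z * hd.orderEquiv.symm y := by
    apply hd.orderEquiv.injective
    rw [map_natCast, map_mul, AlgEquiv.apply_symm_apply, hy]
  refine ⟨norm (hd.orderEquiv.symm y), ?_⟩
  rw [← map_mul, ← h1, QuadraticAlgebra.norm_natCast]

/-- By Cauchy the quotient has an element of additive order p, and N(z) = z z* annihilates the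
quotient. -/
theorem prime_dvd_norm (hd : IsQuadraticDiscriminant d) {I : Ideal (quadOrder d)}
    (hI0 : idealNorm I ≠ 0) {z : QuadraticAlgebra ℤ ((d / 4 : ℕ) : ℤ) ((d % 2 : ℕ) : ℤ)}
    (hI : I = Ideal.span {hd.orderEquiv z}) {p : ℕ} (hp : p.Prime) (hpI : p ∣ idealNorm I) :
    (p : ℤ) ∣ norm z := by
  -- `Nat.card` is 0 on infinite types, so a nonzero ideal norm yields finiteness.
  have hfin : Finite (quadOrder d ⧸ I) := Nat.finite_of_card_ne_zero hI0
  have := Fact.mk hp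
  obtain ⟨x, hx⟩ := exists_prime_addOrderOf_dvd_card' p hpI
  rw [← hx]
  apply addOrderOf_dvd_iff_zsmul_eq_zero.2
  have hmem : ((norm z : ℤ) : quadOrder d) ∈ I := by
    rw [hI, Ideal.mem_span_singleton]
    refine ⟨hd.orderEquiv (star z), ?_⟩
    rw [← map_mul, ← intCast_norm, map_intCast]
  rw [zsmul_eq_mul, ← map_intCast (Ideal.Quotient.mk I), Ideal.Quotient.eq_zero_iff_mem.2 hmem,
    zero_mul]

/-- A generator of an ideal `a ℤ + ((b + √d) / 2) ℤ` is primitive. -/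
theorem not_intCast_dvd_of_isReducedIdeal (hd : IsQuadraticDiscriminant d)
    {I : Ideal (quadOrder d)} (hred : IsReducedIdeal I)
    {z : QuadraticAlgebra ℤ ((d / 4 : ℕ) : ℤ) ((d % 2 : ℕ) : ℤ)}
    (hI : I = Ideal.span {hd.orderEquiv z}) {p : ℤ} (hp : Prime p) :
    ¬ (p : QuadraticAlgebra ℤ ((d / 4 : ℕ) : ℤ) ((d % 2 : ℕ) : ℤ)) ∣ z := by
  rintro hdvd
  obtain ⟨ρ, -, hρ⟩ := hred
  have h1 : ((ρ.b : ℝ) + √(d : ℝ)) / 2 ∈ (ρ.theta : Set ℝ) :=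
    Submodule.subset_span (by simp)
  rw [← hρ] at h1
  obtain ⟨y, hyI, hy⟩ := h1
  rw [SetLike.mem_coe, hI, Ideal.mem_span_singleton] at hyI
  obtain ⟨w, rfl⟩ := hd.orderEquiv.surjective y
  obtain ⟨t, ht⟩ := (map_dvd_iff hd.orderEquiv).1 hyI |> hdvd.trans
  simp only [coe_orderEquiv, embedding_apply, quadOmega] at hy
  -- The ideal contains (b + √d)/2, whose ω-coordinate is 1, so not all its elements are divisible
  -- by p.
  have him : 1 - w.im = 0 := by
    refine hd.eq_zero_of_add_mul_sqrt (x := ρ.b - 2 * w.re - w.im * ((d % 2 : ℕ) : ℤ)) ?_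
    simp only [Int.cast_sub, Int.cast_mul, Int.cast_ofNat, Int.cast_one, Int.cast_natCast]
    linear_combination -2 * hy
  have hpim : p ∣ w.im := (intCast_dvd_iff.1 ⟨t, ht⟩).2
  exact hp.not_dvd_one (by rwa [show (1 : ℤ) = w.im by omega])

/-- The generators of the given reduced principal ideals form a split family. -/
theorem exists_isSplitFamily (hd : IsQuadraticDiscriminant d) {ι : Type*} {n n' n'' : ι → ℕ}
    (hn : ∀ i, 2 ≤ n i)
    (ha : ∀ i, ∃ I : Ideal (quadOrder d), IsReducedIdeal I ∧ I.IsPrincipal ∧ idealNorm I = n i)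
    (hfac : ∀ i, n i = n' i * n'' i) (hne : ∀ i, n' i ≠ 1) (hcop : ∀ i, Nat.Coprime (n' i) d)
    (hdvd : ∀ i, n'' i ∣ d) (hpair : ∀ i j, i ≠ j → Nat.Coprime (n' i) (n' j)) :
    ∃ (α : ι → QuadraticAlgebra ℤ ((d / 4 : ℕ) : ℤ) ((d % 2 : ℕ) : ℤ)) (p : ι → ℤ),
      IsSplitFamily α p ∧ ∀ i, norm (α i) ∣ (n i : ℤ) ^ 2 := by
  choose I hred hprin hnorm using ha
  have hgen : ∀ i, ∃ z, I i = Ideal.span {hd.orderEquiv z} := fun i => by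
    obtain ⟨g, hg⟩ := (hprin i).principal
    obtain ⟨z, rfl⟩ := hd.orderEquiv.surjective g
    exact ⟨z, hg⟩
  choose α hα using hgen
  choose p hp hpn using fun i => Nat.exists_prime_and_dvd (hne i)
  have hsq : ∀ i, norm (α i) ∣ (n i : ℤ) ^ 2 := fun i => by
    rw [← hnorm i]
    exact hd.norm_dvd_sq_idealNorm (hα i)
  have hpd : ∀ i, ¬ p i ∣ d := fun i h =>
    (hp i).one_lt.ne' (Nat.eq_one_of_dvd_coprimes (hcop i) (hpn i) h)
  refine ⟨α, fun i => p i, ⟨fun i => Nat.prime_iff_prime_int.1 (hp i), fun i => ?_, fun i => ?_,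
    fun i => ?_, fun i j hij h => ?_⟩, hsq⟩
  · rw [hd.disc_eq, Int.natCast_dvd_natCast]
    exact hpd i
  · exact hd.not_intCast_dvd_of_isReducedIdeal (hred i) (hα i) (Nat.prime_iff_prime_int.1 (hp i))
  · refine hd.prime_dvd_norm ?_ (hα i) (hp i) ?_
    · rw [hnorm]
      have := hn i
      omega
    · rw [hnorm, hfac]
      exact (hpn i).mul_right _
  -- If p i divided the norm of α j it would divide n' j, against pairwise coprimality, or n'' j and
  -- hence d, against coprimality to d.
  · have h1 := Int.Prime.dvd_pow' (hp i) (h.trans (hsq j))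
    rw [Int.natCast_dvd_natCast, hfac] at h1
    rcases (hp i).dvd_mul.1 h1 with h2 | h2
    · exact (hp i).one_lt.ne' (Nat.eq_one_of_dvd_coprimes (hpair i j hij) (hpn i) h2)
    · exact hpd i (h2.trans (hdvd j))

/-- The lower bound for the fundamental unit, with explicit constants, for `d ≥ 16`. -/
theorem pow_mul_le_log_unit (hd : IsQuadraticDiscriminant d) (h16 : 16 ≤ d)
    {m : ℕ} {n n' n'' : Fin m → ℕ} (hn : ∀ i, 2 ≤ n i)
    (ha : ∀ i, ∃ I : Ideal (quadOrder d), IsReducedIdeal I ∧ I.IsPrincipal ∧ idealNorm I = n i)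
    (hfac : ∀ i, n i = n' i * n'' i) (hne : ∀ i, n' i ≠ 1) (hcop : ∀ i, Nat.Coprime (n' i) d)
    (hdvd : ∀ i, n'' i ∣ d) (hpair : ∀ i j, i ≠ j → Nat.Coprime (n' i) (n' j))
    {ξ : (quadOrder d)ˣ} (hξ : 1 < ((ξ : quadOrder d) : ℝ)) :
    (1 / (8 * (8 * Real.log (∏ i, (n i : ℝ)) + 1) ^ m)) * Real.log √(d : ℝ) ^ (m + 1) ≤
      Real.log ((ξ : quadOrder d) : ℝ) := by
  obtain ⟨α, p, hα, hαn⟩ := hd.exists_isSplitFamily hn ha hfac hne hcop hdvd hpair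
  have hn0 : ∀ i, (n i : ℤ) ^ 2 ≠ 0 := fun i => by
    have := hn i
    positivity
  have hα0 : ∀ i, norm (α i) ≠ 0 := fun i h => hn0 i (zero_dvd_iff.1 (h ▸ hαn i))
  have hn1 : ∀ i, (1 : ℝ) ≤ n i := fun i => by exact_mod_cast (one_le_two.trans (hn i))
  set P : ℝ := ∏ i, (n i : ℝ) with hP
  have hP1 : 1 ≤ P := Finset.one_le_prod fun i _ => hn1 i
  have hlogP : 0 ≤ Real.log P := Real.log_nonneg hP1
  -- With K C ≤ ℓ, the norms cost at most 4K log P ≤ ℓ/2. Out of 2ℓ, subtracting this and 2 log 2 ≤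
  -- ℓ (from d ≥ 16) leaves the gap ℓ/2. The +1 keeps C positive when P = 1.
  set C : ℝ := 8 * Real.log P + 1 with hC
  have hC0 : 0 < C := by positivity
  set ℓ : ℝ := Real.log √(d : ℝ) with hℓ
  have hs4 : (4 : ℝ) ≤ √(d : ℝ) := by
    refine Real.le_sqrt_of_sq_le ?_
    norm_num
    exact_mod_cast h16
  have hs0 : 0 < √(d : ℝ) := by linarith
  have hℓ2 : 2 * Real.log 2 ≤ ℓ := by
    have h := Real.log_le_log (by norm_num) hs4
    rwa [show (4 : ℝ) = 2 ^ 2 by norm_num, Real.log_pow, Nat.cast_ofNat] at h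
  have hlog2 : 0 < Real.log 2 := Real.log_pos one_lt_two
  have hℓ0 : 0 < ℓ := by linarith
  set K : ℕ := ⌊ℓ / C⌋₊ with hK
  have hKle : (K : ℝ) * C ≤ ℓ := by
    rw [← le_div_iff₀ hC0]
    exact Nat.floor_le (by positivity)
  have hKlt : ℓ / C ≤ K + 1 := (Nat.lt_floor_add_one _).le
  have hX : Real.log (∏ i, |((norm (α i) : ℤ) : ℝ)| ^ K) ≤ 2 * (K * Real.log P) := by
    have hpos : ∀ i, 0 < |((norm (α i) : ℤ) : ℝ)| := fun i => by
      rw [abs_pos]; exact_mod_cast hα0 i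
    have hle : ∏ i, |((norm (α i) : ℤ) : ℝ)| ^ K ≤ (P ^ 2) ^ K := by
      rw [hP, ← Finset.prod_pow, ← Finset.prod_pow]
      refine Finset.prod_le_prod (fun i _ => by positivity) fun i _ => ?_
      refine pow_le_pow_left₀ (abs_nonneg _) ?_ _
      have h := Int.le_of_dvd (by have := hn i; positivity) ((abs_dvd _ _).2 (hαn i))
      exact_mod_cast h
    have h := Real.log_le_log (Finset.prod_pos fun i _ => pow_pos (hpos i) K) hle
    rw [Real.log_pow, Real.log_pow, Nat.cast_ofNat] at h
    linarith
  let u := Units.mapEquiv hd.orderEquiv.symm.toMulEquiv ξ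
  have hu : realEmbedding √(d : ℝ) hd.sqrt_sq_eq
      (u : QuadraticAlgebra ℤ ((d / 4 : ℕ) : ℤ) ((d % 2 : ℕ) : ℤ)) = ((ξ : quadOrder d) : ℝ) :=
    congrArg (fun t : quadOrder d => (t : ℝ)) (hd.orderEquiv.apply_symm_apply ξ)
  have hmain := hα.pow_mul_le_log_unit hd.sqrt_sq_eq hα0 hs0 (u := u) (by rwa [hu]) (K := K)
    (half_pos hℓ0) (by
      rw [Real.log_div hs0.ne' two_ne_zero]
      have h8 : (K : ℝ) * C = 8 * (K * Real.log P) + K := by rw [hC]; ring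
      have hK0 : (0 : ℝ) ≤ K := Nat.cast_nonneg K
      linarith)
  rw [hu, Fintype.card_fin] at hmain
  have h1 : (ℓ / C) ^ m * (ℓ / 2) ≤ ((K : ℝ) + 1) ^ m * (ℓ / 2) := by gcongr
  calc 1 / (8 * C ^ m) * ℓ ^ (m + 1) = (ℓ / C) ^ m * (ℓ / 2) / 4 := by
        rw [div_pow, pow_succ]; field_simp; norm_num
    _ ≤ Real.log ((ξ : quadOrder d) : ℝ) := by linarith

end IsQuadraticDiscriminant

/-! ### Assembling the bound uniformly in d. -/

theorem theorem1p3 (m : ℕ) (n : Fin m → ℕ) (hn : ∀ i, 2 ≤ n i)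
    (𝔇 : Set ℕ) (hinf : 𝔇.Infinite) (hdisc : ∀ d ∈ 𝔇, IsQuadraticDiscriminant d)
    (ha : ∀ d ∈ 𝔇, ∀ i, ∃ I : Ideal (quadOrder d),
      IsReducedIdeal I ∧ I.IsPrincipal ∧ idealNorm I = n i)
    (hb : ∀ d ∈ 𝔇, ∃ d₀ : ℕ, IsFundamentalDiscriminantOf d₀ d ∧
      ∃ n' n'' : Fin m → ℕ,
        (∀ i, n i = n' i * n'' i) ∧
        (∀ i, n' i ≠ 1) ∧
        (∀ i, Nat.Coprime (n' i) d) ∧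
        (∀ i, Squarefree (n'' i) ∧ n'' i ∣ d₀) ∧
        (∀ i j, i ≠ j → Nat.Coprime (n' i) (n' j))) :
    ∃ c : ℝ, 0 < c ∧ ∀ (d : ℕ) (hd : d ∈ 𝔇),
      c * (Real.log (√(d : ℝ))) ^ (m + 1) ≤
        Real.log ((fundamentalUnit (hdisc d hd) : quadOrder d) : ℝ) := by
  have hP1 : 1 ≤ ∏ i, (n i : ℝ) :=
    Finset.one_le_prod fun i _ => by exact_mod_cast (one_le_two.trans (hn i))
  have hlogP := Real.log_nonneg hP1
  have hgap : 0 < Real.log (11 / 10) := Real.log_pos (by norm_num)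
  have hlog4 : 0 < Real.log 4 := Real.log_pos (by norm_num)
  set c₁ : ℝ := 1 / (8 * (8 * Real.log (∏ i, (n i : ℝ)) + 1) ^ m)
  -- For d < 16 one has √d ≤ 4, and the absolute lower bound 11/10 for units above 1 suffices.
  set c₂ : ℝ := Real.log (11 / 10) / Real.log 4 ^ (m + 1)
  refine ⟨min c₁ c₂, lt_min (by positivity) (by positivity), fun d hd => ?_⟩
  have hξ := (fundamentalUnit_spec (hdisc d hd)).1
  have hs1 : (1 : ℝ) ≤ √(d : ℝ) := by
    rw [Real.one_le_sqrt]
    exact_mod_cast (by norm_num : 1 ≤ 5).trans (hdisc d hd).five_le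
  have hℓ0 : 0 ≤ Real.log √(d : ℝ) := Real.log_nonneg hs1
  rcases le_or_gt 16 d with h16 | h16
  · obtain ⟨d₀, ⟨-, f, hf⟩, n', n'', hfac, hne, hcop, hdvd, hpair⟩ := hb d hd
    refine le_trans ?_ ((hdisc d hd).pow_mul_le_log_unit h16 hn (ha d hd) hfac hne hcop
      (fun i => (hdvd i).2.trans ⟨f ^ 2, hf⟩) hpair hξ)
    gcongr
    exact min_le_left _ _
  · have hs4 : √(d : ℝ) ≤ 4 := by
      rw [Real.sqrt_le_left (by norm_num)]
      exact_mod_cast h16.le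
    have hℓ4 : Real.log √(d : ℝ) ≤ Real.log 4 := Real.log_le_log (by linarith) hs4
    calc min c₁ c₂ * Real.log √(d : ℝ) ^ (m + 1) ≤ c₂ * Real.log 4 ^ (m + 1) := by
          gcongr
          exact min_le_right _ _
      _ = Real.log (11 / 10) := div_mul_cancel₀ _ (by positivity)
      _ ≤ Real.log ((fundamentalUnit (hdisc d hd) : quadOrder d) : ℝ) :=
          Real.log_le_log (by norm_num) (quadOrder_unit_gap (hdisc d hd) _ hξ)
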